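/- Let $X$ be a finite set with $n=|X|\geq 3$, and let $T(X)$ be the semigroup of all functions from $X$ to $X$ under composition. Let $2\leq r<n$, and let $J_r=\{a\in T(X): |\mathrm{im}(a)|\leq r\}$ be the ideal of transformations of rank at most $r$. The commuting graph of $J_r$ is the simple graph whose vertices are the elements of $J_r$ outside the center $Z(J_r)=\{a\in J_r: ab=ba\text{ for all }b\in J_r\}$, with two vertices $a,b$ adjacent if and only if $a\neq b$ and $ab=ba$. The diameter of a graph is the maximum, over all pairs of vertices, of the length of a shortest path between them (it is $\infty$ if some two vertices are joined by no path). 1. If $n=3$, or if $n\in\{5,6,7\}$ and $r=4$, then the commuting graph of $J_r$ has diameter $4$. 2. In all other cases, the commuting graph of $J_r$ has diameter $5$. -/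

import Mathlib

/-- The commuting graph of a semigroup `S`: the vertices are the non-central elements of `S`, and
two vertices are adjacent when they are distinct and commute. -/
def commutingGraph (S : Type*) [Semigroup S] : SimpleGraph {a : S // a ∉ Set.center S} where
  Adj a b := a ≠ b ∧ (a : S) * (b : S) = (b : S) * (a : S)
  symm := ⟨fun _ _ h => ⟨h.1.symm, h.2.symm⟩⟩
  loopless := ⟨fun _ h => h.1 rfl⟩

/-- The rank of a transformation of `X`, that is, the cardinality of its image. The monoid `T(X)`
of full transformations of `X` under composition is `Function.End X`. -/
noncomputable def transformationRank {X : Type*} (a : Function.End X) : ℕ :=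
  (Set.range (a : X → X)).ncard

theorem transformationRank_mul_le_left {X : Type*} [Finite X] (a b : Function.End X) :
    transformationRank (a * b) ≤ transformationRank a :=
  Set.ncard_le_ncard (Set.range_comp_subset_range (b : X → X) (a : X → X)) (Set.toFinite _)

theorem transformationRank_mul_le_right {X : Type*} [Finite X] (a b : Function.End X) :
    transformationRank (a * b) ≤ transformationRank b := by
  have h : Set.range ((a * b : Function.End X) : X → X) = (a : X → X) '' Set.range (b : X → X) :=
    Set.range_comp (a : X → X) (b : X → X)
  unfold transformationRank
  rw [h]
  exact Set.ncard_image_le (Set.toFinite _)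

/-- `J_r`: the transformations of `X` of rank at most `r`, as a subsemigroup of `T(X)`. -/
def rankIdeal (X : Type*) [Finite X] (r : ℕ) : Subsemigroup (Function.End X) where
  carrier := {a | transformationRank a ≤ r}
  mul_mem' {a b} ha _ := (transformationRank_mul_le_left a b).trans ha

/-- `J_r` is a two-sided ideal of `T(X)`. -/
theorem rankIdeal_isTwoSided (X : Type*) [Finite X] (r : ℕ) (a t : Function.End X)
    (ha : a ∈ rankIdeal X r) : t * a ∈ rankIdeal X r ∧ a * t ∈ rankIdeal X r :=
  ⟨(transformationRank_mul_le_right t a).trans ha, (transformationRank_mul_le_left a t).trans ha⟩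

/-! Let e and f be idempotent powers of a and b. A constant at a fixed point of e, followed by a map
of rank at most 2, links e to f, so distances are at most 5 (`commutingChain_five`). Distance at
most 4 follows if a single map of rank at most r commutes with both e and f, for instance if their
ranges meet or e ∘ f has a fixed point; for n = 3 one of these always occurs. For r = 4 it also
suffices that e ∘ f takes at most two values. If n ≤ 7, disjoint ranges force e or f to have rank at
most 3, and then a failing e can be replaced by a better neighbour of a
(`commutingChain_four_of_ncard_le_three`).

For the lower bounds, a has a single cycle x of length m, and every map of rank at most r commuting
with a has e as an iterate (`Unicyclic.exists_iterate_eq_of_commute`); b is alike, with a disjoint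
cycle y. The middle of a chain of length 4 then commutes with e and f. The phases make e ∘ f rotate
x by one step, so this middle map permutes both cycles and has rank at least 2m, or more if a
further point has incompatible phases. -/

/-- `a` and `b` are joined by `k` steps, each between commuting transformations of rank at
most `r`. -/
def CommutingChain {X : Type*} (r : ℕ) : ℕ → (X → X) → (X → X) → Prop
  | 0, a, b => a = b
  | k + 1, a, b => ∃ c : X → X, (Set.range c).ncard ≤ r ∧ Function.Commute a c ∧
      CommutingChain r k c b

namespace CommutingChain

variable {X : Type*} {r : ℕ}

/-- Stationary steps are allowed, so a chain of length `k` records distance at most `k`. -/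
theorem refl (a : X → X) (ha : (Set.range a).ncard ≤ r) (k : ℕ) : CommutingChain r k a a := by
  induction k with
  | zero => rfl
  | succ k ih => exact ⟨a, ha, Function.Commute.refl a, ih⟩

theorem symm_step {k : ℕ} {a b c : X → X} (hc : (Set.range c).ncard ≤ r)
    (h : CommutingChain r k a b) (hbc : Function.Commute b c) : CommutingChain r (k + 1) a c := by
  induction k generalizing a with
  | zero =>
    obtain rfl : a = b := h
    exact ⟨c, hc, hbc, rfl⟩
  | succ k ih =>
    obtain ⟨d, hd, had, hdb⟩ := h
    exact ⟨d, hd, had, ih hdb⟩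

theorem symm {k : ℕ} {a b : X → X} (ha : (Set.range a).ncard ≤ r)
    (h : CommutingChain r k a b) : CommutingChain r k b a := by
  induction k generalizing a with
  | zero => exact Eq.symm h
  | succ k ih =>
    obtain ⟨d, hd, had, hdb⟩ := h
    exact symm_step ha (ih hd hdb) had.symm

end CommutingChain

theorem notMem_center_rankIdeal {X : Type*} [Finite X] {r : ℕ} (hr : 1 ≤ r) (hrn : r < Nat.card X)
    (a : rankIdeal X r) : a ∉ Set.center (rankIdeal X r) := by
  intro h
  have hfix : ∀ x, (a : Function.End X) x = x := by
    intro x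
    have hx : ((fun _ => x : X → X) : Function.End X) ∈ rankIdeal X r := by
      change (Set.range (fun _ : X => x)).ncard ≤ r
      exact (Set.ncard_le_ncard Set.range_const_subset (Set.toFinite _)).trans (by simpa using hr)
    have := (Set.mem_center_iff.1 h).comm ⟨_, hx⟩
    exact congrFun (congrArg Subtype.val this) x
  have ha : (Set.range (a : Function.End X)).ncard ≤ r := a.2
  have : Set.range (a : Function.End X) = Set.univ :=
    Set.eq_univ_of_forall fun x => ⟨x, hfix x⟩
  rw [this, Set.ncard_univ] at ha
  omega

/-! ### Distances in the commuting graph as chain lengths -/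

section Graph

variable {X : Type*} [Finite X] {r : ℕ}

theorem edist_commutingGraph_le (hr : 1 ≤ r) (hrn : r < Nat.card X) (k : ℕ)
    (a b : {a : rankIdeal X r // a ∉ Set.center (rankIdeal X r)})
    (h : CommutingChain r k (a.1.1 : X → X) b.1.1) :
    (commutingGraph (rankIdeal X r)).edist a b ≤ k := by
  induction k generalizing a with
  | zero =>
    obtain rfl : a = b := Subtype.ext (Subtype.ext h)
    simp
  | succ k ih =>
    obtain ⟨c, hc, hac, hcb⟩ := h
    let c' : {a : rankIdeal X r // a ∉ Set.center (rankIdeal X r)} :=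
      ⟨⟨c, hc⟩, notMem_center_rankIdeal hr hrn _⟩
    have h1 : (commutingGraph (rankIdeal X r)).edist a c' ≤ 1 := by
      by_cases hEq : a = c'
      · rw [hEq, SimpleGraph.edist_self]; simp
      · refine le_of_eq (SimpleGraph.edist_eq_one_iff_adj.2 ⟨hEq, ?_⟩)
        exact Subtype.ext (funext hac)
    calc _ ≤ _ := SimpleGraph.edist_triangle (v := c')
      _ ≤ 1 + (k : ℕ∞) := add_le_add h1 (ih c' hcb)
      _ = _ := by push_cast; rw [add_comm]

theorem commutingChain_of_walk {a b : {a : rankIdeal X r // a ∉ Set.center (rankIdeal X r)}}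
    (w : (commutingGraph (rankIdeal X r)).Walk a b) (k : ℕ) (hk : w.length ≤ k) :
    CommutingChain r k (a.1.1 : X → X) b.1.1 := by
  induction w generalizing k with
  | @nil u => exact CommutingChain.refl _ u.1.2 k
  | @cons u v _ h p ih =>
    obtain _ | k := k
    · simp at hk
    · exact ⟨v.1.1, v.1.2, fun x => congrFun (congrArg Subtype.val h.2) x,
        ih k (by simpa using hk)⟩

theorem commutingChain_of_edist_le {a b : {a : rankIdeal X r // a ∉ Set.center (rankIdeal X r)}}
    {k : ℕ} (h : (commutingGraph (rankIdeal X r)).edist a b ≤ k) :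
    CommutingChain r k (a.1.1 : X → X) b.1.1 := by
  have hne : (commutingGraph (rankIdeal X r)).edist a b ≠ ⊤ :=
    ne_top_of_le_ne_top (ENat.natCast_ne_top k) h
  obtain ⟨w, hw⟩ := SimpleGraph.exists_walk_of_edist_ne_top hne
  refine commutingChain_of_walk w k ?_
  rw [← hw] at h
  exact_mod_cast h

theorem ediam_commutingGraph_eq (hr : 1 ≤ r) (hrn : r < Nat.card X) (k : ℕ)
    (hle : ∀ a b : X → X, (Set.range a).ncard ≤ r → (Set.range b).ncard ≤ r →
      CommutingChain r (k + 1) a b)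
    (hge : ∃ a b : X → X, (Set.range a).ncard ≤ r ∧ (Set.range b).ncard ≤ r ∧
      ¬ CommutingChain r k a b) :
    (commutingGraph (rankIdeal X r)).ediam = ((k + 1 : ℕ) : ℕ∞) := by
  refine le_antisymm (SimpleGraph.ediam_le_of_edist_le fun a b =>
    edist_commutingGraph_le hr hrn _ a b (hle _ _ a.1.2 b.1.2)) ?_
  obtain ⟨a, b, ha, hb, hab⟩ := hge
  let a' : {a : rankIdeal X r // a ∉ Set.center (rankIdeal X r)} :=
    ⟨⟨a, ha⟩, notMem_center_rankIdeal hr hrn _⟩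
  let b' : {a : rankIdeal X r // a ∉ Set.center (rankIdeal X r)} :=
    ⟨⟨b, hb⟩, notMem_center_rankIdeal hr hrn _⟩
  refine le_trans ?_ (SimpleGraph.edist_le_ediam (u := a') (v := b'))
  by_contra hlt
  refine hab (commutingChain_of_edist_le (a := a') (b := b') ?_)
  rw [not_le] at hlt
  push_cast at hlt
  exact Order.le_of_lt_add_one hlt

end Graph

/-! ### Upper bounds through idempotent powers -/

section Idempotent

variable {X : Type*}

theorem exists_iterate_idempotent [Finite X] (a : X → X) :
    ∃ N, 0 < N ∧ ∀ x, a^[N] (a^[N] x) = a^[N] x := by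
  obtain ⟨i, j, hij, h⟩ : ∃ i j : ℕ, i < j ∧ a^[i] = a^[j] := by
    obtain ⟨i, j, hne, h⟩ := Finite.exists_ne_map_eq_of_infinite (fun n : ℕ => a^[n])
    rcases lt_or_gt_of_ne hne with h' | h'
    · exact ⟨i, j, h', h⟩
    · exact ⟨j, i, h', h.symm⟩
  obtain ⟨p, rfl⟩ := Nat.exists_eq_add_of_lt hij
  have step : ∀ k, a^[i + k + (p + 1)] = a^[i + k] := by
    intro k
    rw [show i + k + (p + 1) = (i + p + 1) + k by ring, Function.iterate_add, ← h,
      ← Function.iterate_add]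
  have steps : ∀ q k, a^[i + k + q * (p + 1)] = a^[i + k] := by
    intro q
    induction q with
    | zero => simp
    | succ q ih =>
      intro k
      rw [show i + k + (q + 1) * (p + 1) = i + (k + q * (p + 1)) + (p + 1) by ring, step,
        ← add_assoc, ih]
  -- The exponent is (i + 1)(p + 1), a multiple of the period beyond the preperiod i.
  refine ⟨i + i * p + (p + 1), by omega, fun x => ?_⟩
  rw [← Function.iterate_add_apply]
  have := steps (i + 1) (i * p + (p + 1))
  refine congrFun (Eq.trans ?_ (this.trans ?_)) x <;> congr 1 <;> ring

theorem ncard_range_iterate_le [Finite X] (a : X → X) {N : ℕ} (hN : 0 < N) :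
    (Set.range a^[N]).ncard ≤ (Set.range a).ncard := by
  obtain ⟨k, rfl⟩ := Nat.exists_eq_succ_of_ne_zero hN.ne'
  rw [Function.iterate_succ']
  exact Set.ncard_le_ncard (Set.range_comp_subset_range _ _) (Set.toFinite _)

theorem exists_commuting_idempotent [Finite X] (a : X → X) :
    ∃ e : X → X, (∀ x, e (e x) = e x) ∧ Function.Commute a e ∧
      (Set.range e).ncard ≤ (Set.range a).ncard ∧ Set.range e ⊆ Set.range a ∧
      ∀ x y, a x = a y → e x = e y := by
  obtain ⟨N, hN, h⟩ := exists_iterate_idempotent a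
  refine ⟨a^[N], h, Function.Commute.self_iterate a N, ncard_range_iterate_le a hN, ?_⟩
  obtain ⟨k, rfl⟩ := Nat.exists_eq_succ_of_ne_zero hN.ne'
  refine ⟨?_, fun x y hxy => ?_⟩
  · rw [Function.iterate_succ']
    exact Set.range_comp_subset_range _ _
  · rw [Function.iterate_succ_apply, hxy, Function.iterate_succ_apply]

theorem apply_eq_self_of_mem_range {e : X → X} (he : ∀ x, e (e x) = e x) {x : X}
    (hx : x ∈ Set.range e) : e x = x := by
  obtain ⟨y, rfl⟩ := hx
  exact he y

theorem ncard_range_le_of_forall_mem [Finite X] (g : X → X) (s : Finset X) (h : ∀ x, g x ∈ s) :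
    (Set.range g).ncard ≤ s.card := by
  rw [← Set.ncard_coe_finset]
  exact Set.ncard_le_ncard (by rintro _ ⟨x, rfl⟩; exact h x) (Set.toFinite _)

theorem ncard_range_const_le [Finite X] (x : X) : (Set.range fun _ : X => x).ncard ≤ 1 :=
  ncard_range_le_of_forall_mem _ {x} (by simp)

theorem commute_const {e : X → X} {x : X} (h : e x = x) :
    Function.Commute e (fun _ => x) := fun _ => h

variable [Finite X] {r : ℕ}

/-- Collapse every point other than `x` to `f x`. -/
theorem exists_commute_of_fixed {f : X → X} (hf : ∀ x, f (f x) = f x) (x : X) :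
    ∃ g : X → X, (Set.range g).ncard ≤ 2 ∧ g x = x ∧ Function.Commute g f := by
  classical
  refine ⟨fun z => if z = x then x else f x, ?_, by simp, fun z => ?_⟩
  · refine (ncard_range_le_of_forall_mem _ {x, f x} fun z => ?_).trans Finset.card_le_two
    split_ifs <;> simp
  · dsimp only
    have h1 : f (if z = x then x else f x) = f x := by split_ifs <;> simp [hf]
    rw [h1]
    split_ifs with h2
    · have := hf z
      rw [h2] at this
      exact this.symm
    · rfl

theorem commutingChain_five (hr : 2 ≤ r) [Nonempty X] (a b : X → X)
    (ha : (Set.range a).ncard ≤ r) (hb : (Set.range b).ncard ≤ r) : CommutingChain r 5 a b := by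
  obtain ⟨e, he, hae, hre, -, -⟩ := exists_commuting_idempotent a
  obtain ⟨f, hf, hbf, hrf, -, -⟩ := exists_commuting_idempotent b
  obtain ⟨z⟩ := ‹Nonempty X›
  obtain ⟨g, hg, hgx, hgf⟩ := exists_commute_of_fixed hf (e z)
  exact ⟨e, hre.trans ha, hae, _, (ncard_range_const_le (e z)).trans (by omega),
    commute_const (he z), g, hg.trans hr, (commute_const hgx).symm, f, hrf.trans hb, hgf,
    b, hb, hbf.symm, rfl⟩

theorem exists_commute_of_mem_range_inter {e f : X → X} (he : ∀ x, e (e x) = e x)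
    (hf : ∀ x, f (f x) = f x) {x : X} (hxe : x ∈ Set.range e) (hxf : x ∈ Set.range f) :
    ∃ g : X → X, (Set.range g).ncard ≤ 1 ∧ Function.Commute e g ∧ Function.Commute g f :=
  ⟨_, ncard_range_const_le x, commute_const (apply_eq_self_of_mem_range he hxe),
    (commute_const (apply_eq_self_of_mem_range hf hxf)).symm⟩

/-- For disjoint ranges, send the range of `f` to `f x` and the rest to `x`: `e` maps both values to
`x`, and `f` maps both to `f x`. -/
theorem exists_commute_of_comp_fixed {e f : X → X} (he : ∀ x, e (e x) = e x)
    (hf : ∀ x, f (f x) = f x) {x : X} (hx : e (f x) = x) :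
    ∃ g : X → X, (Set.range g).ncard ≤ 2 ∧ Function.Commute e g ∧ Function.Commute g f := by
  classical
  by_cases hd : ∃ z, z ∈ Set.range e ∧ z ∈ Set.range f
  · obtain ⟨z, hze, hzf⟩ := hd
    obtain ⟨g, hg, h⟩ := exists_commute_of_mem_range_inter he hf hze hzf
    exact ⟨g, hg.trans one_le_two, h⟩
  have hex : e x = x := by rw [← hx, he]
  have hd' : ∀ z, e z ∉ Set.range f := fun z h => hd ⟨_, ⟨z, rfl⟩, h⟩
  refine ⟨fun z => if z ∈ Set.range f then f x else x, ?_, fun z => ?_, fun z => ?_⟩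
  · refine (ncard_range_le_of_forall_mem _ {x, f x} fun z => ?_).trans Finset.card_le_two
    split_ifs <;> simp
  · dsimp only
    rw [if_neg (hd' z)]
    split_ifs
    exacts [hx, hex]
  · dsimp only
    rw [if_pos ⟨z, rfl⟩]
    split_ifs
    exacts [(hf x).symm, rfl]

/-- Points z fall into four classes, by the value `e (f z)` and by whether `e (f (e z))` agrees with
it. Each class contains one of `x₁`, `x₂`, `f x₁`, `f x₂`, and g retracts it to that point. The
second application of `e ∘ f` in the formula undoes the swap. -/
theorem exists_commute_of_comp_swap {e f : X → X} (he : ∀ x, e (e x) = e x)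
    (hf : ∀ x, f (f x) = f x) {x₁ x₂ : X} (hne : x₁ ≠ x₂) (h₁ : e (f x₁) = x₂)
    (h₂ : e (f x₂) = x₁) (hmem : ∀ z, e (f z) = x₁ ∨ e (f z) = x₂) :
    ∃ g : X → X, (Set.range g).ncard ≤ 4 ∧ Function.Commute e g ∧ Function.Commute g f := by
  classical
  have he₁ : e x₁ = x₁ := by rw [← h₂, he]
  have he₂ : e x₂ = x₂ := by rw [← h₁, he]
  refine ⟨fun z => if e (f (e (f (e z)))) = e (f (e (f z))) then e (f (e (f z)))
    else f (e (f (e (f z)))), ?_, fun z => ?_, fun z => ?_⟩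
  · refine (ncard_range_le_of_forall_mem _ {x₁, x₂, f x₁, f x₂} fun z => ?_).trans
      Finset.card_le_four
    rcases hmem z with h | h <;> rw [h] <;> split_ifs <;> simp [h₁, h₂]
  · dsimp only
    rcases hmem z with h | h <;> rcases hmem (e z) with h' | h' <;>
      simp [h, h', h₁, h₂, he, he₁, he₂, hne, hne.symm]
  · dsimp only
    rcases hmem z with h | h <;> rcases hmem (e z) with h' | h' <;>
      simp [h, h', h₁, h₂, hf, hne, hne.symm]

/-- Without a fixed point, `e ∘ f` must interchange its two values. -/
theorem exists_commute_of_ncard_le_two {e f : X → X} (he : ∀ x, e (e x) = e x)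
    (hf : ∀ x, f (f x) = f x) [Nonempty X] (h : (e '' Set.range f).ncard ≤ 2) :
    ∃ g : X → X, (Set.range g).ncard ≤ 4 ∧ Function.Commute e g ∧ Function.Commute g f := by
  by_cases hfix : ∃ x, e (f x) = x
  · obtain ⟨x, hx⟩ := hfix
    obtain ⟨g, hg, h⟩ := exists_commute_of_comp_fixed he hf hx
    exact ⟨g, hg.trans (by norm_num), h⟩
  push Not at hfix
  obtain ⟨z⟩ := ‹Nonempty X›
  have hm : ∀ w, e (f w) ∈ e '' Set.range f := fun w => ⟨_, ⟨w, rfl⟩, rfl⟩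
  have hpair : ({e (f z), e (f (e (f z)))} : Set X) = e '' Set.range f := by
    refine Set.eq_of_subset_of_ncard_le ?_ ?_ (Set.toFinite _)
    · rintro w (rfl | rfl)
      exacts [hm _, hm _]
    · rw [Set.ncard_pair (hfix _).symm]; exact h
  have hmem : ∀ w, e (f w) = e (f z) ∨ e (f w) = e (f (e (f z))) := by
    intro w
    have := hm w
    rw [← hpair] at this
    exact this
  refine exists_commute_of_comp_swap he hf (hfix _).symm rfl ?_ hmem
  exact (hmem _).resolve_right (hfix _)

/-- At most one point y of the range of `a` lies outside that of `e`. Were there no such `q`, each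
point of the range of `f` would be y or be sent to y by `a`; by `hinj`, `e` would take at most two
values there. -/
theorem exists_mem_range_of_ncard_eq_three {a e f : X → X}
    (hinj : ∀ x y, a x = a y → e x = e y) (hea : Set.range e ⊆ Set.range a)
    (ha : (Set.range a).ncard ≤ 4) (h3 : (Set.range e).ncard = 3)
    (hdis : ∀ z, z ∈ Set.range e → z ∉ Set.range f) (h : 2 < (e '' Set.range f).ncard) :
    ∃ q ∈ Set.range f, q ∉ Set.range a ∧ a q ∈ Set.range e := by
  by_contra! hcon
  have hone : (Set.range a \ Set.range e).ncard ≤ 1 := by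
    have := Set.ncard_sdiff_add_ncard_of_subset hea (Set.toFinite _)
    omega
  have huniq : ∀ y ∈ Set.range a \ Set.range e, ∀ y' ∈ Set.range a \ Set.range e, y = y' :=
    fun y hy y' hy' => (Set.ncard_le_one (Set.toFinite _)).1 hone y hy y' hy'
  have hcase : ∀ q ∈ Set.range f, q ∈ Set.range a \ Set.range e ∨
      a q ∈ Set.range a \ Set.range e := by
    intro q hq
    by_cases hqa : q ∈ Set.range a
    · exact Or.inl ⟨hqa, fun h => hdis q h hq⟩
    · exact Or.inr ⟨⟨q, rfl⟩, hcon q hq hqa⟩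
  obtain ⟨y, hy⟩ : ∃ y, y ∈ Set.range a \ Set.range e := by
    obtain ⟨_, ⟨_, ⟨z, rfl⟩, rfl⟩⟩ := Set.nonempty_of_ncard_ne_zero (by omega :
      (e '' Set.range f).ncard ≠ 0)
    rcases hcase _ ⟨z, rfl⟩ with h | h
    exacts [⟨_, h⟩, ⟨_, h⟩]
  obtain ⟨_, ⟨q₁, hq₁, rfl⟩, hne₁⟩ := Set.exists_mem_notMem_of_ncard_lt_ncard
    (s := {e y}) (t := e '' Set.range f) (by rw [Set.ncard_singleton]; omega)
  obtain ⟨_, ⟨q₂, hq₂, rfl⟩, hne₂⟩ := Set.exists_mem_notMem_of_ncard_lt_ncard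
    (s := {e y, e q₁}) (t := e '' Set.range f) ((Set.ncard_insert_le _ _).trans_lt (by simpa))
  simp only [Set.mem_singleton_iff, Set.mem_insert_iff, not_or] at hne₁ hne₂
  have h₁ : a q₁ = y := by
    rcases hcase q₁ hq₁ with h | h
    · exact absurd (congrArg e (huniq _ h _ hy)) hne₁
    · exact huniq _ h _ hy
  have h₂ : a q₂ = y := by
    rcases hcase q₂ hq₂ with h | h
    · exact absurd (congrArg e (huniq _ h _ hy)) hne₂.1
    · exact huniq _ h _ hy
  refine hne₂.2 (hinj _ _ (h₂.trans h₁.symm))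

theorem commutingChain_four_of_ncard_le_three {a b e f : X → X} (ha : (Set.range a).ncard ≤ 4)
    (hb : (Set.range b).ncard ≤ 4) (he : ∀ x, e (e x) = e x) (hae : Function.Commute a e)
    (hre : (Set.range e).ncard ≤ (Set.range a).ncard) (hea : Set.range e ⊆ Set.range a)
    (hinj : ∀ x y, a x = a y → e x = e y) (hf : ∀ x, f (f x) = f x) (hbf : Function.Commute b f)
    (hrf : (Set.range f).ncard ≤ (Set.range b).ncard) (h3 : (Set.range e).ncard ≤ 3)
    [Nonempty X] : CommutingChain 4 4 a b := by
  classical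
  suffices h : ∃ p g : X → X, (Set.range p).ncard ≤ 4 ∧ (Set.range g).ncard ≤ 4 ∧
      Function.Commute a p ∧ Function.Commute p g ∧ Function.Commute g f by
    obtain ⟨p, g, hp, hg, hap, hpg, hgf⟩ := h
    exact ⟨p, hp, hap, g, hg, hpg, f, hrf.trans hb, hgf, b, hb, hbf.symm, rfl⟩
  by_cases hd : ∃ z, z ∈ Set.range e ∧ z ∈ Set.range f
  · obtain ⟨z, hze, hzf⟩ := hd
    obtain ⟨g, hg, h⟩ := exists_commute_of_mem_range_inter he hf hze hzf
    exact ⟨e, g, hre.trans ha, hg.trans (by norm_num), hae, h⟩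
  by_cases h2 : (e '' Set.range f).ncard ≤ 2
  · obtain ⟨g, hg, h⟩ := exists_commute_of_ncard_le_two he hf h2
    exact ⟨e, g, hre.trans ha, hg, hae, h⟩
  rw [not_le] at h2
  have hsub : e '' Set.range f ⊆ Set.range e := Set.image_subset_range _ _
  have hle := Set.ncard_le_ncard hsub (Set.toFinite _)
  obtain ⟨q, hqf, hqa, haq⟩ := exists_mem_range_of_ncard_eq_three hinj hea ha
    (by omega) (fun z hze hzf => hd ⟨z, hze, hzf⟩) h2
  -- Making q a fixed point raises the rank to at most 4 and keeps commutation with a, because q is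
  -- not in the range of a and e fixes a q.
  refine ⟨Function.update e q q, fun _ => q, ?_, (ncard_range_const_le q).trans (by norm_num),
    fun z => ?_, commute_const (Function.update_self ..),
    (commute_const (apply_eq_self_of_mem_range hf hqf)).symm⟩
  · refine (Set.ncard_le_ncard (t := insert q (Set.range e)) ?_ (Set.toFinite _)).trans
      ((Set.ncard_insert_le _ _).trans (by omega))
    rintro _ ⟨z, rfl⟩
    by_cases hz : z = q
    · simp [hz]
    · simp [Function.update_of_ne hz]
  · have haz : a z ≠ q := fun h => hqa ⟨z, h⟩
    rw [Function.update_of_ne haz]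
    by_cases hz : z = q
    · rw [hz, Function.update_self, apply_eq_self_of_mem_range he haq]
    · rw [Function.update_of_ne hz, hae]

theorem commutingChain_four_of_card_le_seven [Nonempty X] (hX : Nat.card X ≤ 7) (a b : X → X)
    (ha : (Set.range a).ncard ≤ 4) (hb : (Set.range b).ncard ≤ 4) : CommutingChain 4 4 a b := by
  obtain ⟨e, he, hae, hre, hea, hinj⟩ := exists_commuting_idempotent a
  obtain ⟨f, hf, hbf, hrf, hfb, hinj'⟩ := exists_commuting_idempotent b
  by_cases hd : ∃ z, z ∈ Set.range e ∧ z ∈ Set.range f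
  · obtain ⟨z, hze, hzf⟩ := hd
    obtain ⟨g, hg, heg, hgf⟩ := exists_commute_of_mem_range_inter he hf hze hzf
    exact ⟨e, hre.trans ha, hae, g, hg.trans (by norm_num), heg, f, hrf.trans hb, hgf,
      b, hb, hbf.symm, rfl⟩
  -- Two disjoint ranges cannot both have four points.
  have hcard : (Set.range e).ncard + (Set.range f).ncard ≤ 7 := by
    rw [← Set.ncard_union_eq (Set.disjoint_left.2 fun z hze hzf => hd ⟨z, hze, hzf⟩)
      (Set.toFinite _) (Set.toFinite _)]
    exact (Set.ncard_le_card _).trans hX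
  rcases le_or_gt (Set.range e).ncard 3 with h | h
  · exact commutingChain_four_of_ncard_le_three ha hb he hae hre hea hinj hf hbf hrf h
  · exact (commutingChain_four_of_ncard_le_three hb ha hf hbf hrf hfb hinj' he hae hre
      (by omega)).symm hb

theorem commutingChain_four_of_card_eq_three (hr : 2 ≤ r) (hX : Nat.card X = 3) (a b : X → X)
    (ha : (Set.range a).ncard ≤ r) (hb : (Set.range b).ncard ≤ r) : CommutingChain r 4 a b := by
  have : Nonempty X := (Nat.card_pos_iff.1 (by omega)).1
  obtain ⟨e, he, hae, hre, -, -⟩ := exists_commuting_idempotent a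
  obtain ⟨f, hf, hbf, hrf, -, -⟩ := exists_commuting_idempotent b
  suffices h : ∃ g : X → X, (Set.range g).ncard ≤ 2 ∧ Function.Commute e g ∧
      Function.Commute g f by
    obtain ⟨g, hg, heg, hgf⟩ := h
    exact ⟨e, hre.trans ha, hae, g, hg.trans hr, heg, f, hrf.trans hb, hgf,
      b, hb, hbf.symm, rfl⟩
  by_cases hd : ∃ z, z ∈ Set.range e ∧ z ∈ Set.range f
  · obtain ⟨z, hze, hzf⟩ := hd
    obtain ⟨g, hg, h⟩ := exists_commute_of_mem_range_inter he hf hze hzf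
    exact ⟨g, hg.trans one_le_two, h⟩
  have hcard : (Set.range e).ncard + (Set.range f).ncard ≤ 3 := by
    rw [← Set.ncard_union_eq (Set.disjoint_left.2 fun z hze hzf => hd ⟨z, hze, hzf⟩)
      (Set.toFinite _) (Set.toFinite _), ← hX]
    exact Set.ncard_le_card _
  obtain ⟨z⟩ := ‹Nonempty X›
  rcases le_or_gt (Set.range e).ncard 1 with h | h
  · refine exists_commute_of_comp_fixed he hf (x := e z) ?_
    exact (Set.ncard_le_one (Set.toFinite _)).1 h _ ⟨_, rfl⟩ _ ⟨_, rfl⟩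
  · have hf1 : (Set.range f).ncard ≤ 1 := by omega
    obtain ⟨g, hg, hfg, hge⟩ := exists_commute_of_comp_fixed hf he (x := f z)
      ((Set.ncard_le_one (Set.toFinite _)).1 hf1 _ ⟨_, rfl⟩ _ ⟨_, rfl⟩)
    exact ⟨g, hg, hge.symm, hfg.symm⟩

end Idempotent

/-! ### Transformations with one cycle and their commuting maps -/

/-- The transformation `a` has a single cycle `x`, of length `m`; `phase` says at which place of
the cycle a point ends up, and `depth` is its distance from the cycle. -/
structure Unicyclic {X : Type*} {m : ℕ} (a : X → X) (x : ZMod m → X) (phase : X → ZMod m)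
    (depth : X → ℕ) : Prop where
  phase_cycle : ∀ i, phase (x i) = i
  map_cycle : ∀ i, a (x i) = x (i + 1)
  phase_map : ∀ z, phase (a z) = phase z + 1
  depth_map : ∀ z, depth (a z) = depth z - 1
  eq_cycle : ∀ z, depth z = 0 → z = x (phase z)

namespace Unicyclic

variable {X : Type*} {m : ℕ} {a : X → X} {x : ZMod m → X} {π : X → ZMod m} {δ : X → ℕ}

theorem injective_cycle (h : Unicyclic a x π δ) : Function.Injective x :=
  Function.LeftInverse.injective h.phase_cycle

theorem iterate_cycle (h : Unicyclic a x π δ) (k : ℕ) (i : ZMod m) : a^[k] (x i) = x (i + k) := by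
  induction k with
  | zero => simp
  | succ k ih => rw [Function.iterate_succ_apply', ih, h.map_cycle]; push_cast; rw [add_assoc]

theorem depth_iterate (h : Unicyclic a x π δ) (k : ℕ) (z : X) : δ (a^[k] z) = δ z - k := by
  induction k with
  | zero => simp
  | succ k ih => rw [Function.iterate_succ_apply', h.depth_map, ih]; omega

theorem phase_iterate (h : Unicyclic a x π δ) (k : ℕ) (z : X) : π (a^[k] z) = π z + k := by
  induction k with
  | zero => simp
  | succ k ih => rw [Function.iterate_succ_apply', h.phase_map, ih]; push_cast; rw [add_assoc]

theorem depth_cycle (h : Unicyclic a x π δ) [NeZero m] (i : ZMod m) : δ (x i) = 0 := by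
  have h1 := h.iterate_cycle (m * δ (x i)) i
  have h2 := h.depth_iterate (m * δ (x i)) (x i)
  rw [h1] at h2
  simp only [Nat.cast_mul, CharP.cast_eq_zero, zero_mul, add_zero] at h2
  rw [h2]
  have := Nat.le_mul_of_pos_left (δ (x i)) (NeZero.pos m)
  omega

theorem exists_iterate_eq [Finite X] [NeZero m] (h : Unicyclic a x π δ) :
    ∃ M, a^[M] = x ∘ π := by
  obtain ⟨K, hK⟩ := (Set.finite_range δ).bddAbove
  refine ⟨m * K, funext fun z => ?_⟩
  have h0 : δ (a^[m * K] z) = 0 := by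
    rw [h.depth_iterate]
    have := hK ⟨z, rfl⟩
    have := Nat.le_mul_of_pos_left K (NeZero.pos m)
    omega
  rw [h.eq_cycle _ h0, h.phase_iterate]
  simp

/-- An idempotent `c` commuting with `a` fixes the cycle pointwise. If it hit a point off the cycle,
`hk` would yield T with c T deeper than `k`; then c T and its first `k` images under `a` lie off the
cycle in the range of `c`, whose size is at least m + k + 1 > r. -/
theorem eq_of_idempotent [Finite X] [NeZero m] (h : Unicyclic a x π δ) {r k : ℕ} (hr : r ≤ m + k)
    (hk : ∀ s, 0 < δ s → ∃ T j, a^[j] s = a^[k] T ∧ k < δ T) {c : X → X}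
    (hc : (Set.range c).ncard ≤ r) (hac : Function.Commute a c) (hcc : ∀ z, c (c z) = c z) :
    c = x ∘ π := by
  have hxc : ∀ z, c (x (π z)) = x (π (c z)) := by
    obtain ⟨M, hM⟩ := h.exists_iterate_eq
    have := hac.iterate_left M
    rw [hM] at this
    exact fun z => (this z).symm
  have hfix : ∀ i, c (x i) = x i := by
    intro i
    obtain ⟨j, hj⟩ : ∃ j, c (x 0) = x j := ⟨π (c (x 0)), by
      have := hxc (x 0)
      rwa [h.phase_cycle] at this⟩
    have hj' : c (x j) = x j := by rw [← hj, hcc]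
    obtain ⟨n, hn⟩ := ZMod.natCast_zmod_surjective (i - j)
    have := h.iterate_cycle n j
    rw [hn, add_sub_cancel] at this
    rw [← this, ← hac.iterate_left n, hj']
  by_cases hall : ∀ z, δ (c z) = 0
  · funext z
    rw [h.eq_cycle _ (hall z), ← hxc, hfix]
    rfl
  push Not at hall
  obtain ⟨z, hz⟩ := hall
  obtain ⟨T, j, hT, hδ⟩ := hk (c z) (Nat.pos_of_ne_zero hz)
  have hcT : a^[k] (c T) = a^[k] T := by
    rw [hac.iterate_left k T, ← hT, ← hac.iterate_left j, hcc]
  have hδw : k < δ (c T) := by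
    have := congrArg δ hcT
    rw [h.depth_iterate, h.depth_iterate] at this
    omega
  let φ : ZMod m ⊕ Fin (k + 1) → Set.range c :=
    Sum.elim (fun i => ⟨x i, x i, hfix i⟩)
      (fun i => ⟨a^[i] (c T), a^[i] T, (hac.iterate_left i T).symm⟩)
  have hδφ : ∀ i : Fin (k + 1), δ (φ (Sum.inr i)) = δ (c T) - i := fun i => h.depth_iterate i (c T)
  have hφ : Function.Injective φ := by
    rintro (i | i) (j | j) hij
    · exact congrArg Sum.inl (h.injective_cycle (congrArg Subtype.val hij))
    · have := hδφ j
      rw [← hij] at this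
      have h0 : δ (φ (Sum.inl i)) = 0 := h.depth_cycle i
      omega
    · have := hδφ i
      rw [hij] at this
      have h0 : δ (φ (Sum.inl j)) = 0 := h.depth_cycle j
      omega
    · have h1 := hδφ i
      rw [hij, hδφ j] at h1
      exact congrArg Sum.inr (Fin.ext (by omega))
  have hcard := Nat.card_le_card_of_injective φ hφ
  rw [Nat.card_sum, Nat.card_zmod, Nat.card_fin, Nat.card_coe_set_eq] at hcard
  omega

theorem exists_iterate_eq_of_commute [Finite X] [NeZero m] (h : Unicyclic a x π δ) {r k : ℕ}
    (hr : r ≤ m + k) (hk : ∀ s, 0 < δ s → ∃ T j, a^[j] s = a^[k] T ∧ k < δ T) {c : X → X}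
    (hc : (Set.range c).ncard ≤ r) (hac : Function.Commute a c) : ∃ N, c^[N] = x ∘ π := by
  obtain ⟨N, hN, hcN⟩ := exists_iterate_idempotent c
  exact ⟨N, h.eq_of_idempotent hr hk ((ncard_range_iterate_le c hN).trans hc)
    (hac.iterate_right N) hcN⟩

/-- With one entrance `p` to the cycle, a single deep point `T` serves every `s`. -/
theorem exists_iterate_of_unique_depth_one (h : Unicyclic a x π δ) {p T : X} {k : ℕ}
    (hp : ∀ z, δ z = 1 → z = p) (hT : δ T = k + 1) (s : X) (hs : 0 < δ s) :
    ∃ T j, a^[j] s = a^[k] T ∧ k < δ T := by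
  refine ⟨T, δ s - 1, ?_, by omega⟩
  rw [hp (a^[δ s - 1] s) (by rw [h.depth_iterate]; omega),
    hp (a^[k] T) (by rw [h.depth_iterate]; omega)]

theorem comp_equiv {Y : Type*} (h : Unicyclic a x π δ) (τ : X ≃ Y) :
    Unicyclic (τ ∘ a ∘ τ.symm) (τ ∘ x) (π ∘ τ.symm) (δ ∘ τ.symm) where
  phase_cycle i := by simp [h.phase_cycle]
  map_cycle i := by simp [h.map_cycle]
  phase_map z := by simp [h.phase_map]
  depth_map z := by simp [h.depth_map]
  eq_cycle z hz := by
    have := h.eq_cycle _ hz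
    simp [← this]

end Unicyclic

/-- Every transformation of rank at most `r` that commutes with `a` has `e` as an iterate. -/
def ForcesIterate {X : Type*} (r : ℕ) (a e : X → X) : Prop :=
  ∀ c : X → X, (Set.range c).ncard ≤ r → Function.Commute a c → ∃ N, c^[N] = e

theorem not_commutingChain_three {X : Type*} {r : ℕ} {a b e f : X → X}
    (ha : ForcesIterate r a e) (hb : ForcesIterate r b f) (hef : ¬ Function.Commute e f) :
    ¬ CommutingChain r 3 a b := by
  rintro ⟨p, hp, hap, q, hq, hpq, _, -, hqb, rfl⟩
  obtain ⟨N, rfl⟩ := ha p hp hap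
  obtain ⟨N', rfl⟩ := hb q hq hqb.symm
  exact hef (hpq.iterate_iterate N N')

theorem not_commutingChain_four {X : Type*} {r : ℕ} {a b e f : X → X}
    (ha : ForcesIterate r a e) (hb : ForcesIterate r b f)
    (hef : ∀ g : X → X, (Set.range g).ncard ≤ r → Function.Commute g e → ¬ Function.Commute g f) :
    ¬ CommutingChain r 4 a b := by
  rintro ⟨p, hp, hap, g, hg, hpg, q, hq, hgq, _, -, hqb, rfl⟩
  obtain ⟨N, rfl⟩ := ha p hp hap
  obtain ⟨N', rfl⟩ := hb q hq hqb.symm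
  exact hef g hg (hpg.iterate_left N).symm (hgq.iterate_right N')

/-! ### Maps commuting with two crossed idempotents -/

section CrossedIdempotents

variable {X : Type*} {m : ℕ} {x y : ZMod m → X} {π ρ : X → ZMod m} {s u : ZMod m}

/-- The composite of the two idempotents rotates `x` by s + u = 1, and `g` commutes with this
rotation. -/
theorem exists_shift_of_commute [NeZero m] (hyπ : ∀ i, π (y i) = i + s) (hxρ : ∀ i, ρ (x i) = i + u)
    (hsu : s + u = 1) {g : X → X} (hxx : ∀ i, π (x i) = i)
    (he : Function.Commute g (x ∘ π)) (hf : Function.Commute g (y ∘ ρ)) :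
    ∃ j, ∀ i, g (x i) = x (i + j) := by
  have hstep : ∀ i, g (x (i + 1)) = x (π (y (ρ (g (x i))))) := by
    intro i
    have h1 : g (y (ρ (x i))) = y (ρ (g (x i))) := hf (x i)
    have h2 : g (x (π (y (ρ (x i))))) = x (π (g (y (ρ (x i))))) := he (y (ρ (x i)))
    rw [h1, hxρ, hyπ] at h2
    rw [← h2, ← hsu]
    congr 2
    ring
  obtain ⟨j, hj⟩ : ∃ j, g (x 0) = x j := ⟨π (g (x 0)), by
    have := he (x 0)
    simpa [hxx] using this⟩
  refine ⟨j, fun i => ?_⟩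
  obtain ⟨n, rfl⟩ := ZMod.natCast_zmod_surjective i
  induction n with
  | zero => simpa using hj
  | succ n ih =>
    push_cast
    rw [hstep, ih, hxρ, hyπ, ← hsu]
    congr 1
    ring

variable [Finite X] [NeZero m]

theorem two_mul_le_ncard_of_commute (hd : ∀ i j, x i ≠ y j) (hxx : ∀ i, π (x i) = i)
    (hyy : ∀ i, ρ (y i) = i) (hyπ : ∀ i, π (y i) = i + s) (hxρ : ∀ i, ρ (x i) = i + u)
    (hsu : s + u = 1) {g : X → X} (he : Function.Commute g (x ∘ π))
    (hf : Function.Commute g (y ∘ ρ)) (t : Set X) (ht : t ⊆ Set.range g)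
    (htx : ∀ i, x i ∉ t) (hty : ∀ i, y i ∉ t) : 2 * m + t.ncard ≤ (Set.range g).ncard := by
  obtain ⟨j, hj⟩ := exists_shift_of_commute hyπ hxρ hsu hxx he hf
  obtain ⟨l, hl⟩ := exists_shift_of_commute hxρ hyπ (by rw [add_comm, hsu]) hyy hf he
  have hx : (Set.range x).ncard = m := by
    rw [← Nat.card_coe_set_eq, Nat.card_range_of_injective (Function.LeftInverse.injective hxx),
      Nat.card_zmod]
  have hy : (Set.range y).ncard = m := by
    rw [← Nat.card_coe_set_eq, Nat.card_range_of_injective (Function.LeftInverse.injective hyy),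
      Nat.card_zmod]
  have hxy : (Set.range x ∪ Set.range y).ncard = 2 * m := by
    rw [Set.ncard_union_eq (Set.disjoint_left.2 ?_) (Set.toFinite _) (Set.toFinite _), hx, hy,
      two_mul]
    rintro _ ⟨i, rfl⟩ ⟨k, hk⟩
    exact hd i k hk.symm
  have hall : ((Set.range x ∪ Set.range y) ∪ t).ncard = 2 * m + t.ncard := by
    rw [Set.ncard_union_eq (Set.disjoint_left.2 ?_) (Set.toFinite _) (Set.toFinite _), hxy]
    rintro _ (⟨i, rfl⟩ | ⟨i, rfl⟩)
    exacts [htx i, hty i]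
  rw [← hall]
  refine Set.ncard_le_ncard (Set.union_subset (Set.union_subset ?_ ?_) ht) (Set.toFinite _)
  · rintro _ ⟨i, rfl⟩
    exact ⟨x (i - j), by rw [hj, sub_add_cancel]⟩
  · rintro _ ⟨i, rfl⟩
    exact ⟨y (i - l), by rw [hl, sub_add_cancel]⟩

/-- An idempotent iterate of `g` fixes both cycles, hence preserves both phases of `w`. These match
no point of `x`, where ρ = π + u, and none of `y`, where π = ρ + s, so the image of `w` is an extra
point. -/
theorem two_mul_lt_ncard_of_commute (hd : ∀ i j, x i ≠ y j) (hxx : ∀ i, π (x i) = i)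
    (hyy : ∀ i, ρ (y i) = i) (hyπ : ∀ i, π (y i) = i + s) (hxρ : ∀ i, ρ (x i) = i + u)
    (hsu : s + u = 1) {w : X} (hw₁ : ρ w ≠ π w + u) (hw₂ : π w ≠ ρ w + s) {g : X → X}
    (he : Function.Commute g (x ∘ π)) (hf : Function.Commute g (y ∘ ρ)) :
    2 * m < (Set.range g).ncard := by
  obtain ⟨N, hN, hgg⟩ := exists_iterate_idempotent g
  refine lt_of_lt_of_le ?_ (ncard_range_iterate_le g hN)
  replace he := he.iterate_left N
  replace hf := hf.iterate_left N
  generalize g^[N] = h at hgg he hf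
  obtain ⟨j, hj⟩ := exists_shift_of_commute hyπ hxρ hsu hxx he hf
  obtain ⟨l, hl⟩ := exists_shift_of_commute hxρ hyπ (by rw [add_comm, hsu]) hyy hf he
  have hx : ∀ i, h (x i) = x i := by
    intro i
    have := hgg (x (i - j))
    rwa [hj, sub_add_cancel] at this
  have hy : ∀ i, h (y i) = y i := by
    intro i
    have := hgg (y (i - l))
    rwa [hl, sub_add_cancel] at this
  have hπ : π (h w) = π w := by
    have : h (x (π w)) = x (π (h w)) := he w
    rw [hx] at this
    rw [← hxx (π (h w)), ← this, hxx]
  have hρ : ρ (h w) = ρ w := by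
    have : h (y (ρ w)) = y (ρ (h w)) := hf w
    rw [hy] at this
    rw [← hyy (ρ (h w)), ← this, hyy]
  have := two_mul_le_ncard_of_commute hd hxx hyy hyπ hxρ hsu he hf {h w}
    (by rintro _ rfl; exact ⟨w, rfl⟩) ?_ ?_
  · rw [Set.ncard_singleton] at this
    omega
  · rintro i hi
    rw [← Set.mem_singleton_iff.1 hi] at hπ hρ
    rw [hxx] at hπ
    rw [hxρ, hπ] at hρ
    exact hw₁ hρ.symm
  · rintro i hi
    rw [← Set.mem_singleton_iff.1 hi] at hπ hρ
    rw [hyy] at hρ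
    rw [hyπ, hρ] at hπ
    exact hw₂ hπ.symm

end CrossedIdempotents

/-! ### Explicit pairs at large distance -/

section Models

variable {m : ℕ} {W : Type*}

/-- The `m`-cycle on the first summand, entered at `s` by the path through the second summand,
which all remaining points enter at `c`. -/
def pathMap (s c : ZMod m) : (ZMod m ⊕ ZMod m) ⊕ W → (ZMod m ⊕ ZMod m) ⊕ W
  | .inl (.inl i) => .inl (.inl (i + 1))
  | .inl (.inr i) => if i = -1 then .inl (.inl s) else .inl (.inr (i + 1))
  | .inr _ => .inl (.inr c)

/-- The phase of a point under `pathMap s c`. -/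
def pathPhase (s c : ZMod m) : (ZMod m ⊕ ZMod m) ⊕ W → ZMod m
  | .inl (.inl i) => i
  | .inl (.inr i) => i + s
  | .inr _ => c + s - 1

/-- The depth of a point under `pathMap s c`. -/
def pathDepth (c : ZMod m) : (ZMod m ⊕ ZMod m) ⊕ W → ℕ
  | .inl (.inl _) => 0
  | .inl (.inr i) => m - i.val
  | .inr _ => m - c.val + 1

/-- The `m`-cycle on the first summand, entered directly from all other points. -/
def starMap (s : ZMod m) : (ZMod m ⊕ ZMod m) ⊕ W → (ZMod m ⊕ ZMod m) ⊕ W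
  | .inl (.inl i) => .inl (.inl (i + 1))
  | .inl (.inr i) => .inl (.inl (i + s + 1))
  | .inr _ => .inl (.inl 0)

/-- The phase of a point under `starMap s`. -/
def starPhase (s : ZMod m) : (ZMod m ⊕ ZMod m) ⊕ W → ZMod m
  | .inl (.inl i) => i
  | .inl (.inr i) => i + s
  | .inr _ => -1

/-- The depth of a point under `starMap s`. -/
def starDepth : (ZMod m ⊕ ZMod m) ⊕ W → ℕ
  | .inl (.inl _) => 0
  | _ => 1

theorem ZMod.val_neg_one_of_neZero [NeZero m] : (-1 : ZMod m).val = m - 1 := by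
  obtain ⟨n, rfl⟩ := Nat.exists_eq_succ_of_ne_zero (NeZero.ne m)
  exact ZMod.val_neg_one n

theorem ZMod.val_add_one_of_ne_neg_one [NeZero m] {i : ZMod m} (hi : i ≠ -1) :
    (i + 1).val = i.val + 1 := by
  have h1 := i.val_lt
  have h2 : i.val ≠ m - 1 := fun h =>
    hi (ZMod.val_injective _ (h.trans ZMod.val_neg_one_of_neZero.symm))
  have : Fact (1 < m) := ⟨by omega⟩
  rw [ZMod.val_add_of_lt (by rw [ZMod.val_one]; omega), ZMod.val_one]

theorem unicyclic_pathMap [NeZero m] (s c : ZMod m) :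
    Unicyclic (pathMap s c : (ZMod m ⊕ ZMod m) ⊕ W → _) (fun i => .inl (.inl i)) (pathPhase s c)
      (pathDepth c) where
  phase_cycle _ := rfl
  map_cycle _ := rfl
  phase_map := by
    rintro ((i | i) | w)
    · rfl
    · by_cases hi : i = -1
      · simp [pathMap, pathPhase, hi]
      · simp only [pathMap, hi, if_false, pathPhase]; ring
    · simp only [pathMap, pathPhase]; ring
  depth_map := by
    rintro ((i | i) | w)
    · rfl
    · have := NeZero.pos m
      by_cases hi : i = -1
      · simp only [pathMap, pathDepth, hi, if_true, ZMod.val_neg_one_of_neZero]; omega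
      · simp only [pathMap, hi, if_false, pathDepth, ZMod.val_add_one_of_ne_neg_one hi]; omega
    · simp [pathMap, pathDepth]
  eq_cycle := by
    rintro ((i | i) | w) h
    · rfl
    · have := i.val_lt
      simp only [pathDepth] at h
      omega
    · simp [pathDepth] at h

theorem eq_of_pathDepth_eq_one [NeZero m] (c : ZMod m) (z : (ZMod m ⊕ ZMod m) ⊕ W)
    (hz : pathDepth c z = 1) : z = .inl (.inr (-1)) := by
  obtain (i | i) | w := z
  · simp [pathDepth] at hz
  · simp only [pathDepth] at hz
    have : i = -1 := by
      refine ZMod.val_injective _ ?_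
      rw [ZMod.val_neg_one_of_neZero]
      omega
    rw [this]
  · have := c.val_lt
    simp only [pathDepth] at hz
    omega

theorem unicyclic_starMap (s : ZMod m) :
    Unicyclic (starMap s : (ZMod m ⊕ ZMod m) ⊕ W → _) (fun i => .inl (.inl i)) (starPhase s)
      starDepth where
  phase_cycle _ := rfl
  map_cycle _ := rfl
  phase_map := by
    rintro ((i | i) | w)
    · rfl
    · rfl
    · simp [starMap, starPhase]
  depth_map := by rintro ((i | i) | w) <;> rfl
  eq_cycle := by rintro ((i | i) | w) h <;> first | rfl | simp [starDepth] at h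

theorem ncard_range_inl [NeZero m] :
    (Set.range (Sum.inl : ZMod m ⊕ ZMod m → (ZMod m ⊕ ZMod m) ⊕ W)).ncard = 2 * m := by
  rw [← Nat.card_coe_set_eq, Nat.card_range_of_injective Sum.inl_injective, Nat.card_sum,
    Nat.card_zmod, two_mul]

theorem ncard_range_pathMap_le [NeZero m] [Finite W] (s c : ZMod m) :
    (Set.range (pathMap s c : (ZMod m ⊕ ZMod m) ⊕ W → _)).ncard ≤ 2 * m := by
  rw [← ncard_range_inl (W := W)]
  refine Set.ncard_le_ncard ?_ (Set.toFinite _)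
  rintro _ ⟨(i | i) | w, rfl⟩ <;> simp only [pathMap]
  · exact ⟨_, rfl⟩
  · split_ifs <;> exact ⟨_, rfl⟩
  · exact ⟨_, rfl⟩

theorem ncard_range_pathMap_le_of_ne_zero [NeZero m] [Finite W] (s : ZMod m) {c : ZMod m}
    (hc : c ≠ 0) :
    (Set.range (pathMap s c : (ZMod m ⊕ ZMod m) ⊕ W → _)).ncard ≤ 2 * m - 1 := by
  rw [← ncard_range_inl (W := W), ← Set.ncard_sdiff_singleton_of_mem
    (Set.mem_range_self (Sum.inr 0))]
  refine Set.ncard_le_ncard ?_ (Set.toFinite _)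
  rintro _ ⟨(i | i) | w, rfl⟩ <;> simp only [pathMap]
  · exact ⟨⟨_, rfl⟩, by simp⟩
  · split_ifs with hi
    · exact ⟨⟨_, rfl⟩, by simp⟩
    · exact ⟨⟨_, rfl⟩, by simpa [← eq_neg_iff_add_eq_zero] using hi⟩
  · exact ⟨⟨_, rfl⟩, by simpa using hc⟩

theorem ncard_range_starMap_le [NeZero m] (s : ZMod m) :
    (Set.range (starMap s : (ZMod m ⊕ ZMod m) ⊕ W → _)).ncard ≤ m := by
  have h : (Set.range fun i : ZMod m => (.inl (.inl i) : (ZMod m ⊕ ZMod m) ⊕ W)).ncard = m := by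
    rw [← Nat.card_coe_set_eq, Nat.card_range_of_injective
      (fun i j h => Sum.inl_injective (Sum.inl_injective h)), Nat.card_zmod]
  refine (Set.ncard_le_ncard ?_ (Set.finite_range _)).trans h.le
  rintro _ ⟨(i | i) | w, rfl⟩ <;> exact ⟨_, rfl⟩

theorem exists_not_commutingChain_of_unicyclic {X : Type*} [Finite X] [NeZero m] {r k : ℕ}
    (τ : (ZMod m ⊕ ZMod m) ⊕ W ≃ X)
    (F : ZMod m → (ZMod m ⊕ ZMod m) ⊕ W → (ZMod m ⊕ ZMod m) ⊕ W)
    (P : ZMod m → (ZMod m ⊕ ZMod m) ⊕ W → ZMod m) (D : (ZMod m ⊕ ZMod m) ⊕ W → ℕ)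
    (hF : ∀ s, Unicyclic (F s) (fun i => .inl (.inl i)) (P s) D)
    (hP : ∀ s i, P s (.inl (.inr i)) = i + s) (hrank : ∀ s, (Set.range (F s)).ncard ≤ r)
    (hr : r ≤ m + k) (hk : ∀ s z, 0 < D z → ∃ T j, (F s)^[j] z = (F s)^[k] T ∧ k < D T) :
    ∃ a b : X → X, (Set.range a).ncard ≤ r ∧ (Set.range b).ncard ≤ r ∧
      ¬ CommutingChain r 3 a b ∧
      (r < 2 * m ∨ (r = 2 * m ∧ 3 ≤ m ∧ ∃ w, ∀ s, P s (.inr w) = s - 1) →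
        ¬ CommutingChain r 4 a b) := by
  have rank : ∀ (σ : (ZMod m ⊕ ZMod m) ⊕ W ≃ X) (s : ZMod m),
      (Set.range (σ ∘ F s ∘ σ.symm)).ncard ≤ r := by
    intro σ s
    rw [Set.range_comp, Set.ncard_image_of_injective _ σ.injective,
      σ.symm.surjective.range_comp]
    exact hrank s
  have forces : ∀ (σ : (ZMod m ⊕ ZMod m) ⊕ W ≃ X) (s : ZMod m),
      ForcesIterate r (σ ∘ F s ∘ σ.symm)
        ((σ ∘ fun i => .inl (.inl i)) ∘ (P s ∘ σ.symm)) := by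
    intro σ s c hc hac
    refine ((hF s).comp_equiv σ).exists_iterate_eq_of_commute hr ?_ hc hac
    intro z hz
    obtain ⟨T, j, hT, hD⟩ := hk s (σ.symm z) hz
    have hconj : ∀ n z, (σ ∘ F s ∘ σ.symm)^[n] z = σ ((F s)^[n] (σ.symm z)) := by
      intro n z
      have : Function.Semiconj σ (F s) (σ ∘ F s ∘ σ.symm) := fun z => by simp
      rw [this.iterate_right n, σ.apply_symm_apply]
    exact ⟨σ T, j, by rw [hconj, hconj, hT, σ.symm_apply_apply], by simpa using hD⟩
  -- Swapping the two copies of `ZMod m` makes the second map cycle through the other copy.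
  let σ : (ZMod m ⊕ ZMod m) ⊕ W ≃ X :=
    (Equiv.sumCongr (Equiv.sumComm _ _) (Equiv.refl W)).trans τ
  have hne : ∀ i j, (τ ∘ fun i => .inl (.inl i)) i ≠ (σ ∘ fun i => .inl (.inl i)) j := by
    intro i j h
    simp [σ] at h
  -- The shifts -1 and 2 sum to 1, and both are nonzero once m ≥ 3, which makes the phases of w
  -- incompatible.
  have hyπ : ∀ i, (P (-1) ∘ τ.symm) ((σ ∘ fun i => .inl (.inl i)) i) = i + (-1) := by
    intro i
    simp [σ, hP]
  have hxρ : ∀ i, (P 2 ∘ σ.symm) ((τ ∘ fun i => .inl (.inl i)) i) = i + 2 := by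
    intro i
    simp [σ, hP]
  have ha := (hF (-1)).comp_equiv τ
  have hb := (hF 2).comp_equiv σ
  refine ⟨_, _, rank τ (-1), rank σ 2, not_commutingChain_three (forces τ _) (forces σ _)
    (fun h => hne _ _ (h (τ (.inl (.inl 0))))), fun hcase =>
    not_commutingChain_four (forces τ _) (forces σ _) fun g hg he hf => ?_⟩
  rcases hcase with hlt | ⟨rfl, hm, w, hw⟩
  · have := two_mul_le_ncard_of_commute hne ha.phase_cycle hb.phase_cycle hyπ hxρ
      (by ring) he hf ∅ (Set.empty_subset _) (fun _ h => h) (fun _ h => h)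
    rw [Set.ncard_empty] at this
    omega
  · refine absurd hg (not_le.2 (two_mul_lt_ncard_of_commute hne ha.phase_cycle hb.phase_cycle
      hyπ hxρ (by ring) (w := τ (.inr w)) ?_ ?_ he hf))
    · have : Fact (1 < m) := ⟨by omega⟩
      simp only [σ, Function.comp_apply, Equiv.symm_trans_apply, Equiv.symm_apply_apply,
        Equiv.sumCongr_symm, Equiv.sumCongr_apply, Sum.map_inr, Equiv.refl_symm, Equiv.refl_apply,
        hw]
      intro h
      exact one_ne_zero (α := ZMod m) (by linear_combination h)
    · have h2 : (2 : ZMod m) ≠ 0 := by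
        intro h
        have h2 : ((2 : ℕ) : ZMod m) = 0 := by exact_mod_cast h
        rw [ZMod.natCast_eq_zero_iff] at h2
        exact absurd (Nat.le_of_dvd two_pos h2) (by omega)
      simp only [σ, Function.comp_apply, Equiv.symm_trans_apply, Equiv.symm_apply_apply,
        Equiv.sumCongr_symm, Equiv.sumCongr_apply, Sum.map_inr, Equiv.refl_symm, Equiv.refl_apply,
        hw]
      intro h
      exact h2 (by linear_combination -h)

theorem nonempty_equiv_model {X : Type*} [Finite X] [NeZero m]
    (hX : 2 * m ≤ Nat.card X) :
    Nonempty ((ZMod m ⊕ ZMod m) ⊕ Fin (Nat.card X - 2 * m) ≃ X) := by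
  rw [← Finite.card_eq, Nat.card_sum, Nat.card_sum, Nat.card_zmod, Nat.card_fin]
  omega

/-- An extra point attached to the start of the path has depth m + 1, enough for k = m. -/
theorem exists_not_commutingChain_two_mul {X : Type*} [Finite X] (hm : 1 ≤ m)
    (hX : 2 * m < Nat.card X) : ∃ a b : X → X, (Set.range a).ncard ≤ 2 * m ∧
      (Set.range b).ncard ≤ 2 * m ∧ ¬ CommutingChain (2 * m) 3 a b ∧
      (3 ≤ m → ¬ CommutingChain (2 * m) 4 a b) := by
  have : NeZero m := ⟨by omega⟩
  obtain ⟨τ⟩ := nonempty_equiv_model (X := X) hX.le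
  let w : Fin (Nat.card X - 2 * m) := ⟨0, by omega⟩
  obtain ⟨a, b, ha, hb, h3, h4⟩ := exists_not_commutingChain_of_unicyclic (k := m) τ
    (fun s => pathMap s 0) (fun s => pathPhase s 0) (pathDepth 0) (fun s => unicyclic_pathMap s 0)
    (fun _ _ => rfl) (fun s => ncard_range_pathMap_le s 0) (two_mul m).le
    (fun s => (unicyclic_pathMap s 0).exists_iterate_of_unique_depth_one
      (eq_of_pathDepth_eq_one 0) (T := .inr w) (by simp [pathDepth]))
  exact ⟨a, b, ha, hb, h3, fun hm3 => h4 (Or.inr ⟨rfl, hm3, w, fun s => by simp [pathPhase]⟩)⟩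

/-- Attaching extra points at 1 keeps the start of the path out of the image, saving one in rank;
that start has depth `m`, enough for k = m - 1. -/
theorem exists_not_commutingChain_two_mul_sub_one {X : Type*} [Finite X] (hm : 2 ≤ m)
    (hX : 2 * m ≤ Nat.card X) : ∃ a b : X → X, (Set.range a).ncard ≤ 2 * m - 1 ∧
      (Set.range b).ncard ≤ 2 * m - 1 ∧ ¬ CommutingChain (2 * m - 1) 4 a b := by
  have : NeZero m := ⟨by omega⟩
  have : Fact (1 < m) := ⟨by omega⟩
  obtain ⟨τ⟩ := nonempty_equiv_model (X := X) hX
  obtain ⟨a, b, ha, hb, -, h4⟩ := exists_not_commutingChain_of_unicyclic (k := m - 1) τ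
    (fun s => pathMap s 1) (fun s => pathPhase s 1) (pathDepth 1) (fun s => unicyclic_pathMap s 1)
    (fun _ _ => rfl) (fun s => ncard_range_pathMap_le_of_ne_zero s one_ne_zero) (by omega)
    (fun s => (unicyclic_pathMap s 1).exists_iterate_of_unique_depth_one
      (eq_of_pathDepth_eq_one 1) (T := .inl (.inr 0)) (by simp [pathDepth]; omega))
  exact ⟨a, b, ha, hb, h4 (Or.inl (by omega))⟩

/-- The cycle alone uses up the rank, so k = 0 suffices. -/
theorem exists_not_commutingChain_self {X : Type*} [Finite X] (hm : 1 ≤ m)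
    (hX : 2 * m ≤ Nat.card X) : ∃ a b : X → X, (Set.range a).ncard ≤ m ∧
      (Set.range b).ncard ≤ m ∧ ¬ CommutingChain m 4 a b := by
  have : NeZero m := ⟨by omega⟩
  obtain ⟨τ⟩ := nonempty_equiv_model (X := X) hX
  obtain ⟨a, b, ha, hb, -, h4⟩ := exists_not_commutingChain_of_unicyclic (k := 0) τ
    starMap starPhase starDepth unicyclic_starMap (fun _ _ => rfl) ncard_range_starMap_le le_rfl
    (fun s z hz => ⟨z, 0, rfl, hz⟩)
  exact ⟨a, b, ha, hb, h4 (Or.inl (by omega))⟩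

end Models

theorem mainTheorem1 {X : Type*} [Finite X] (n r : ℕ) (hX : Nat.card X = n)
    (hn : 3 ≤ n) (hr : 2 ≤ r) (hrn : r < n) :
    ((n = 3 ∨ ((n = 5 ∨ n = 6 ∨ n = 7) ∧ r = 4)) →
      (commutingGraph (rankIdeal X r)).ediam = 4) ∧
    (¬ (n = 3 ∨ ((n = 5 ∨ n = 6 ∨ n = 7) ∧ r = 4)) →
      (commutingGraph (rankIdeal X r)).ediam = 5) := by
  subst hX
  have : Nonempty X := (Nat.card_pos_iff.1 (by omega)).1
  refine ⟨fun h => ?_, fun h => ?_⟩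
  · refine ediam_commutingGraph_eq (by omega) hrn 3 (fun a b ha hb => ?_) ?_
    · rcases h with h | ⟨h, rfl⟩
      · exact commutingChain_four_of_card_eq_three hr h a b ha hb
      · exact commutingChain_four_of_card_le_seven (by omega) a b ha hb
    · obtain ⟨m, hm, rfl⟩ : ∃ m, 1 ≤ m ∧ r = 2 * m := ⟨r / 2, by omega, by omega⟩
      obtain ⟨a, b, ha, hb, h3, -⟩ := exists_not_commutingChain_two_mul hm hrn
      exact ⟨a, b, ha, hb, h3⟩
  · refine ediam_commutingGraph_eq (by omega) hrn 4
      (fun a b ha hb => commutingChain_five hr a b ha hb) ?_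
    rcases Nat.even_or_odd' r with ⟨m, rfl | rfl⟩
    · rcases le_or_gt 3 m with hm | hm
      · obtain ⟨a, b, ha, hb, -, h4⟩ :=
          exists_not_commutingChain_two_mul (X := X) (m := m) (by omega) hrn
        exact ⟨a, b, ha, hb, h4 hm⟩
      -- Here r is 2 or 4, and the excluded cases leave 2r ≤ n.
      · exact exists_not_commutingChain_self (by omega) (by omega)
    · exact exists_not_commutingChain_two_mul_sub_one (X := X) (m := m + 1) (by omega) (by omega)
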